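/- **Theorem (ANNA simulates low-rank attention).** *Precision.* A fixed-point number of precision $p$ is an integer multiple of $2^{-p}$ of absolute value at most $2^p$. All maps $Q',K',Q,K,V,\psi$ below are arbitrary maps on vectors, applied to matrices row by row, whose output entries are fixed-point numbers of the stated precision. *Low-rank attention transformers.* A low-rank attention head of rank $r$ and embedding dimension $m$ is given by maps $Q',K':\mathbb R^d\to\mathbb R^r$ and $V:\mathbb R^d\to\mathbb R^m$; on $X\in\mathbb R^{N\times d}$ it computes $Q'(X)\,(K'(X)^{\top}V(X))$. A layer with $H$ heads computes $X\mapsto\sum_{h=1}^H \mathrm{head}_h(X)W_h$ with matrices $W_h\in\mathbb R^{m\times d}$. A transformer of depth $L$ applies $L$ layers $\mathbb R^{N\times d}\to\mathbb R^{N\times d}$ and then a map $\psi:\mathbb R^d\to\mathbb R^d$ to each row. *ANNA transformers.* They are defined in the same way, with low-rank heads replaced by ANNA heads (and $W_h$ also having fixed-point entries). An ANNA head has maps $Q,K:\mathbb R^d\to\mathbb R^m$, $V:\mathbb R^d\to\mathbb R^m$ and parameters $\varrho,c,\ell,\eta$. With $q_i,k_i,v_i$ the $i$-th rows of $Q(X),K(X),V(X)$,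 it returns $\sum_j w_{i,j}v_j$ in row $i$, for some (possibly random) weights $w_{i,j}\ge0$ with $\sum_j w_{i,j}=1$ such that, with probability at least $1-\eta$, for all $i,j$: $w_{i,j}>0\Rightarrow \|q_i-k_j\|\le c\varrho$, and $\|q_i-k_j\|\le \varrho\Rightarrow w_{i,j}\ge \frac{1}{(n_i-1)\ell+1}$, where $n_i=\#\{j':\|q_i-k_{j'}\|\le c\varrho\}$. The hash-table implementation of a head samples functions $h_{u,t}$ ($u\le\ell$, $t\le z$) from a locality-sensitive family, puts $g_u=(h_{u,1},\dots,h_{u,z})$, and returns in row $i$ the sum of $v_j$ over all pairs $(u,j)$ with $g_u(k_j)=g_u(q_i)$, divided by the number of these pairs. *Claim.* Let $0<\varepsilon<\varepsilon'<1$. There is a constant $C_L$ depending only on $\varepsilon,\varepsilon'$, and for every $C$ there is a constant $C'$ depending only on $\varepsilon,\varepsilon',C$, such that the following holds for every $N\ge2$. Let $T$ be a low-rank attention transformer with depth $L$, $H$ heads per layer, rank $r$, embedding dimension $m$, token dimension $d$ and precision $p$, where $Hrm\le C N^{\varepsilon}$ (that is, $rm\le CN^{\varepsilon}$ for a single head)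 and $p\le C\log N$. Then there is an ANNA transformer $T'$ with depth at most $C_L L$, at most $C'N^{(\varepsilon'-\varepsilon)/4}$ heads per layer, embedding dimension at most $C'N^{\varepsilon'}$, token dimension $d'$ with $d\le d'\le d+C'N^{\varepsilon'}$ and precision at most $C'\log N$, that simulates $T$: for every $X\in\mathbb R^{N\times d}$, the output of $T'$ on $X$ (padded by zero columns) is $T(X)$ (padded by zero columns). More precisely: 1. For every $c>1$ there is $\varrho>0$ such that, in every head and on every input of that head, every query has a key within distance $\varrho$, and for every choice of the weights of all heads that realizes the parameters $\varrho,\ c,\ \ell=1,\ \eta=0$ and for every $X$, the output is correct almost surely. 2. For arbitrarily large $c$ there are $\varrho>0$ and $0<p_2<p_1\le1$ with $\frac{\log(1/p_1)}{\log(1/p_2)}\le\frac1{c^2}$, and a random hash function on Euclidean space for which two points at distance at most $\varrho$ collide with probability at least $p_1$ and two points at distance more than $c\varrho$ collide with probability at most $p_2$, such that the hash-table implementation of $T'$ with this family, with any numbers $\ell,z\ge1$ of tables and of hash functions per table, always divides by a positive count and always returns the correct output. -/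

import Mathlib

open MeasureTheory

noncomputable section

/-- Apply a map row by row to an `N × d` matrix. -/
def rowwise {N d m : ℕ} (f : (Fin d → ℝ) → (Fin m → ℝ)) (X : Matrix (Fin N) (Fin d) ℝ) :
    Matrix (Fin N) (Fin m) ℝ :=
  Matrix.of fun i => f (X i)

/-- Extend a vector by zeros (or cut it off, if `d' < d`). -/
def padVec {d : ℕ} (d' : ℕ) (x : Fin d → ℝ) : Fin d' → ℝ :=
  fun k => if h : (k : ℕ) < d then x ⟨k, h⟩ else 0

/-- Fixed-point numbers of precision `p`: integer multiples of `2⁻ᵖ` of absolute value at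
most `2ᵖ`. -/
def IsFixedPoint (p : ℕ) (x : ℝ) : Prop :=
  ∃ a : ℤ, |a| ≤ 2 ^ (2 * p) ∧ x = (a : ℝ) / 2 ^ p

/-! ### Low-rank attention -/

/-- A low-rank attention head: feature maps `Q'`, `K'` of rank `r` and a value map. -/
structure LowRankHead (d r m : ℕ) where
  Q : (Fin d → ℝ) → (Fin r → ℝ)
  K : (Fin d → ℝ) → (Fin r → ℝ)
  V : (Fin d → ℝ) → (Fin m → ℝ)

/-- `Q'(X) (K'(X)ᵀ V(X))`. -/
def LowRankHead.attn {N d r m : ℕ} (A : LowRankHead d r m) (X : Matrix (Fin N) (Fin d) ℝ) :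
    Matrix (Fin N) (Fin m) ℝ :=
  rowwise A.Q X * ((rowwise A.K X).transpose * rowwise A.V X)

structure LowRankLayer (d r m H : ℕ) where
  head : Fin H → LowRankHead d r m
  W : Fin H → Matrix (Fin m) (Fin d) ℝ

def LowRankLayer.apply {N d r m H : ℕ} (f : LowRankLayer d r m H)
    (X : Matrix (Fin N) (Fin d) ℝ) : Matrix (Fin N) (Fin d) ℝ :=
  ∑ h, (f.head h).attn X * f.W h

/-- A low-rank attention transformer with `L` layers, `H` heads per layer, rank `r`, embedding
dimension `m`, acting on sequences of `d`-dimensional tokens. -/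
structure LowRankTransformer (d r m H L : ℕ) where
  layer : Fin L → LowRankLayer d r m H
  ψ : (Fin d → ℝ) → (Fin d → ℝ)

/-- `ψ(X⁽ᴸ⁾)`, where `X⁽⁰⁾ = X` and `X⁽ˡ⁾ = f_l(X⁽ˡ⁻¹⁾)`. -/
def LowRankTransformer.eval {N d r m H L : ℕ} (T : LowRankTransformer d r m H L)
    (X : Matrix (Fin N) (Fin d) ℝ) : Matrix (Fin N) (Fin d) ℝ :=
  rowwise T.ψ (Fin.foldl L (fun Y l => (T.layer l).apply Y) X)

/-- The element-wise maps output fixed-point numbers of precision `p`. -/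
structure LowRankTransformer.HasPrecision {d r m H L : ℕ} (T : LowRankTransformer d r m H L)
    (p : ℕ) : Prop where
  query : ∀ l h x k, IsFixedPoint p (((T.layer l).head h).Q x k)
  key : ∀ l h x k, IsFixedPoint p (((T.layer l).head h).K x k)
  value : ∀ l h x k, IsFixedPoint p (((T.layer l).head h).V x k)
  output : ∀ x k, IsFixedPoint p (T.ψ x k)

/-! ### Approximate nearest neighbor attention -/

/-- The element-wise maps of an ANNA head; queries and keys live in Euclidean space. -/
structure ANNAHead (d m : ℕ) where
  Q : (Fin d → ℝ) → EuclideanSpace ℝ (Fin m)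
  K : (Fin d → ℝ) → EuclideanSpace ℝ (Fin m)
  V : (Fin d → ℝ) → (Fin m → ℝ)

open Classical in
/-- The keys within distance `t` of the `i`-th query, each counted with multiplicity
(that is, as indices). -/
def ANNAHead.nbhd {N d m : ℕ} (A : ANNAHead d m) (X : Matrix (Fin N) (Fin d) ℝ) (i : Fin N)
    (t : ℝ) : Finset (Fin N) :=
  Finset.univ.filter fun j => dist (A.Q (X i)) (A.K (X j)) ≤ t

/-- The two conditions on the attention weights of an ANNA mechanism with radius `r`,
approximation factor `c` and spread parameter `ell`. -/
structure ANNAHead.GoodWeights {N d m : ℕ} (A : ANNAHead d m) (X : Matrix (Fin N) (Fin d) ℝ)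
    (r c ell : ℝ) (w : Matrix (Fin N) (Fin N) ℝ) : Prop where
  near_of_pos : ∀ i j, 0 < w i j → j ∈ A.nbhd X i (c * r)
  le_of_near : ∀ i j, j ∈ A.nbhd X i r →
    1 / ((((A.nbhd X i (c * r)).card : ℝ) - 1) * ell + 1) ≤ w i j

/-- The (possibly randomized) weights `w` realize the ANNA mechanism with the query and key maps
of `A` and parameters `r, c, ell, η`: the weights are nonnegative and sum to one, and on each
input the two conditions fail with probability at most `η`. -/
structure ANNAHead.IsMechanism {N d m : ℕ} (A : ANNAHead d m) {Ω : Type} [MeasurableSpace Ω]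
    (P : Measure Ω) (r c ell η : ℝ)
    (w : Ω → Matrix (Fin N) (Fin d) ℝ → Matrix (Fin N) (Fin N) ℝ) : Prop where
  nonneg : ∀ ω X i j, 0 ≤ w ω X i j
  sum_eq_one : ∀ ω X i, ∑ j, w ω X i j = 1
  good : ∀ X, P {ω | ¬ A.GoodWeights X r c ell (w ω X)} ≤ ENNReal.ofReal η

/-! ### Locality-sensitive hashing and the hash-table implementation -/

/-- A random hash function `h` on `ℝᵐ` that is `(r, R, p₁, p₂)`-sensitive. -/
structure IsLSHFamily {m : ℕ} {Ω U : Type} [MeasurableSpace Ω] (μ : Measure Ω)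
    (h : Ω → EuclideanSpace ℝ (Fin m) → U) (r R p₁ p₂ : ℝ) : Prop where
  prob : IsProbabilityMeasure μ
  measurable : ∀ x y, MeasurableSet {s | h s x = h s y}
  near : ∀ x y, dist x y ≤ r → ENNReal.ofReal p₁ ≤ μ {s | h s x = h s y}
  far : ∀ x y, R < dist x y → μ {s | h s x = h s y} ≤ ENNReal.ofReal p₂

open Classical in
/-- The indices of the keys stored in the bucket `code` of the hash table of `g`. -/
def ANNAHead.bucket {N d m : ℕ} (A : ANNAHead d m) {C : Type}
    (g : EuclideanSpace ℝ (Fin m) → C) (X : Matrix (Fin N) (Fin d) ℝ) (code : C) :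
    Finset (Fin N) :=
  Finset.univ.filter fun j => g (A.K (X j)) = code

/-- The count collected for the `i`-th query from the `ell` hash tables. -/
def ANNAHead.hashCount {N d m ell : ℕ} (A : ANNAHead d m) {C : Type}
    (g : Fin ell → EuclideanSpace ℝ (Fin m) → C) (X : Matrix (Fin N) (Fin d) ℝ) (i : Fin N) :
    ℕ :=
  ∑ u, (A.bucket (g u) X (g u (A.Q (X i)))).card

/-- The sum of values collected for the `i`-th query from the `ell` hash tables. -/
def ANNAHead.hashSum {N d m ell : ℕ} (A : ANNAHead d m) {C : Type}
    (g : Fin ell → EuclideanSpace ℝ (Fin m) → C) (X : Matrix (Fin N) (Fin d) ℝ) (i : Fin N) :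
    Fin m → ℝ :=
  ∑ u, ∑ j ∈ A.bucket (g u) X (g u (A.Q (X i))), A.V (X j)

/-- The output of the hash-table algorithm: sum of values divided by count. -/
def ANNAHead.hashAttn {N d m ell : ℕ} (A : ANNAHead d m) {C : Type}
    (g : Fin ell → EuclideanSpace ℝ (Fin m) → C) (X : Matrix (Fin N) (Fin d) ℝ) :
    Matrix (Fin N) (Fin m) ℝ :=
  Matrix.of fun i k => A.hashSum g X i k / (A.hashCount g X i : ℝ)

/-- The hash codes `g_u = (h_{u,1}, …, h_{u,z})`, for `ell` tables and `z` sampled hash functions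
per table. -/
def hashCode {m ell z : ℕ} {Ω U : Type} (h : Ω → EuclideanSpace ℝ (Fin m) → U)
    (seed : Fin ell → Fin z → Ω) (u : Fin ell) (x : EuclideanSpace ℝ (Fin m)) : Fin z → U :=
  fun t => h (seed u t) x

/-! ### ANNA transformers -/

structure ANNALayer (d m H : ℕ) where
  head : Fin H → ANNAHead d m
  W : Fin H → Matrix (Fin m) (Fin d) ℝ

/-- An ANNA transformer with `L` layers, `H` heads per layer and embedding dimension `m`, acting
on sequences of `d`-dimensional tokens. -/
structure ANNATransformer (d m H L : ℕ) where
  layer : Fin L → ANNALayer d m H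
  ψ : (Fin d → ℝ) → (Fin d → ℝ)

/-- The output of the transformer if `att l h` is the function computed by the attention
mechanism of head `h` in layer `l`. -/
def ANNATransformer.run {N d m H L : ℕ} (T : ANNATransformer d m H L)
    (att : Fin L → Fin H → Matrix (Fin N) (Fin d) ℝ → Matrix (Fin N) (Fin m) ℝ)
    (X : Matrix (Fin N) (Fin d) ℝ) : Matrix (Fin N) (Fin d) ℝ :=
  rowwise T.ψ (Fin.foldl L (fun Y l => ∑ h, att l h Y * (T.layer l).W h) X)

/-- The output of the transformer with the attention weights `w l h`. -/
def ANNATransformer.evalWeights {N d m H L : ℕ} (T : ANNATransformer d m H L)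
    (w : Fin L → Fin H → Matrix (Fin N) (Fin d) ℝ → Matrix (Fin N) (Fin N) ℝ)
    (X : Matrix (Fin N) (Fin d) ℝ) : Matrix (Fin N) (Fin d) ℝ :=
  T.run (fun l h Y => w l h Y * rowwise ((T.layer l).head h).V Y) X

/-- The output of the transformer if every head is implemented by the hash-table algorithm, with
the hash functions `h (seed l a u t)`. -/
def ANNATransformer.evalHash {N d m H L ell z : ℕ} (T : ANNATransformer d m H L)
    {Ω U : Type} (h : Ω → EuclideanSpace ℝ (Fin m) → U)
    (seed : Fin L → Fin H → Fin ell → Fin z → Ω)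
    (X : Matrix (Fin N) (Fin d) ℝ) : Matrix (Fin N) (Fin d) ℝ :=
  T.run (fun l a Y => ((T.layer l).head a).hashAttn (hashCode h (seed l a)) Y) X

/-- The element-wise maps and the output matrices consist of fixed-point numbers of
precision `p`. -/
structure ANNATransformer.HasPrecision {d m H L : ℕ} (T : ANNATransformer d m H L)
    (p : ℕ) : Prop where
  query : ∀ l h x k, IsFixedPoint p (((T.layer l).head h).Q x k)
  key : ∀ l h x k, IsFixedPoint p (((T.layer l).head h).K x k)
  value : ∀ l h x k, IsFixedPoint p (((T.layer l).head h).V x k)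
  matrix : ∀ l h a b, IsFixedPoint p ((T.layer l).W h a b)
  output : ∀ x k, IsFixedPoint p (T.ψ x k)

/-- As an ANNA transformer, `T'` computes `F` on context length `N`: for every approximation
factor `c > 1` there is a radius `r > 0` such that every query has an `r`-near key, and every
collection of attention mechanisms with parameters `r`, `c`, spread parameter `1` and failure
probability `0` makes `T'` output `F X` almost surely, for each `X`. Tokens are padded by
zeros. -/
def ANNATransformer.Computes {N d d' m H L : ℕ} (T' : ANNATransformer d' m H L)
    (F : Matrix (Fin N) (Fin d) ℝ → Matrix (Fin N) (Fin d) ℝ) : Prop :=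
  ∀ c : ℝ, 1 < c → ∃ r : ℝ, 0 < r ∧
    (∀ l h (Y : Matrix (Fin N) (Fin d') ℝ) i, (((T'.layer l).head h).nbhd Y i r).Nonempty) ∧
    ∀ (Ω : Type) [MeasurableSpace Ω] (P : Measure Ω) [IsProbabilityMeasure P]
      (w : Fin L → Fin H → Ω → Matrix (Fin N) (Fin d') ℝ → Matrix (Fin N) (Fin N) ℝ),
      (∀ l h, ((T'.layer l).head h).IsMechanism P r c 1 0 (w l h)) →
      ∀ X : Matrix (Fin N) (Fin d) ℝ, ∀ᵐ ω ∂P,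
        T'.evalWeights (fun l h => w l h ω) (rowwise (padVec d') X) =
          rowwise (padVec d') (F X)

/-- The hash-table implementation of `T'` computes `F` on context length `N`: for arbitrarily
large `c` there are `r > 0` and an `(r, c r, p₁, p₂)`-sensitive hash family of quality at most
`1 / c²` such that, for any numbers `ell`, `z` of tables and of hash functions per table and any
sampled hash functions, no query meets only empty buckets and the output is `F X`, for
each `X`. -/
def ANNATransformer.HashComputes {N d d' m H L : ℕ} (T' : ANNATransformer d' m H L)
    (F : Matrix (Fin N) (Fin d) ℝ → Matrix (Fin N) (Fin d) ℝ) : Prop :=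
  ∀ c₀ : ℝ, ∃ c r p₁ p₂ : ℝ, c₀ ≤ c ∧ 1 < c ∧ 0 < r ∧ 0 < p₂ ∧ p₂ < p₁ ∧ p₁ ≤ 1 ∧
    Real.log (1 / p₁) / Real.log (1 / p₂) ≤ 1 / c ^ 2 ∧
    ∃ (Ω U : Type) (_ : MeasurableSpace Ω) (μ : Measure Ω)
      (h : Ω → EuclideanSpace ℝ (Fin m) → U),
      IsLSHFamily μ h r (c * r) p₁ p₂ ∧
      ∀ (ell z : ℕ), 1 ≤ ell → 1 ≤ z → ∀ seed : Fin L → Fin H → Fin ell → Fin z → Ω,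
        (∀ l a (Y : Matrix (Fin N) (Fin d') ℝ) i,
          0 < ((T'.layer l).head a).hashCount (hashCode h (seed l a)) Y i) ∧
        ∀ X : Matrix (Fin N) (Fin d) ℝ,
          T'.evalHash h seed (rowwise (padVec d') X) = rowwise (padVec d') (F X)

end

/-! Write `D = H * r * m`. Row `i` of a low-rank layer is a sum over the `D` triples (head, rank
index, value index): a query feature of token `i`, times the sum over all tokens of a product of key
and value features, times an entry of `W`. Only that sum mixes tokens, and it does not depend on the
query.

So one ANNA layer with two heads replaces one low-rank layer. In the first, query and key are both
the query features scaled to integers; a token then matches only tokens with the same features, and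
averaging over them returns its own features. In the second, all queries and keys are zero, and the
head returns the mean over all tokens of the key-value products. The two results are stored in
separate slots, and the element-wise maps of the next layer (or the final `ψ`), being arbitrary,
first multiply by `N` and combine them with the matrices `W` (`decode_simulateStep`). Hence `W`
needs no bounded precision.

Both heads need only exact matching of integer vectors. ANNA weights give it once `c * ρ < 1`,
because distinct integer vectors have distance at least one (`mul_eq_classMean`). Hash tables give
it for every seed if the hash is a randomly shifted unit grid: every shift separates integer
vectors, while the randomness makes the family locality-sensitive (`isLSHFamily_gridHash`). -/

/-! ### Exact matching: heads with equal integral queries and keys -/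

/-- Queries and keys agree and are integer vectors. -/
structure ANNAHead.IsIntegral {d m : ℕ} (A : ANNAHead d m) : Prop where
  query_eq_key : A.Q = A.K
  exists_int : ∀ y k, ∃ n : ℤ, A.K y k = n

/-- The mean of the values over all tokens whose key equals the query. -/
noncomputable def ANNAHead.classMean {N d m : ℕ} (A : ANNAHead d m)
    (Y : Matrix (Fin N) (Fin d) ℝ) : Matrix (Fin N) (Fin m) ℝ :=
  Matrix.of fun i k => (∑ j ∈ A.nbhd Y i 0, A.V (Y j) k) / ((A.nbhd Y i 0).card : ℝ)

theorem ANNAHead.mem_nbhd {N d m : ℕ} {A : ANNAHead d m} {Y : Matrix (Fin N) (Fin d) ℝ}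
    {i j : Fin N} {t : ℝ} : j ∈ A.nbhd Y i t ↔ dist (A.Q (Y i)) (A.K (Y j)) ≤ t := by
  simp [ANNAHead.nbhd]

theorem EuclideanSpace.abs_sub_le_dist {m : ℕ} (x y : EuclideanSpace ℝ (Fin m)) (k : Fin m) :
    |x k - y k| ≤ dist x y := by
  rw [dist_eq_norm]
  simpa using PiLp.norm_apply_le (x - y) k

theorem EuclideanSpace.eq_of_dist_lt_one {m : ℕ} {x y : EuclideanSpace ℝ (Fin m)}
    (hx : ∀ k, ∃ n : ℤ, x k = n) (hy : ∀ k, ∃ n : ℤ, y k = n) (h : dist x y < 1) : x = y := by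
  ext k
  obtain ⟨a, ha⟩ := hx k
  obtain ⟨b, hb⟩ := hy k
  have hk := (EuclideanSpace.abs_sub_le_dist x y k).trans_lt h
  rw [ha, hb] at hk ⊢
  have : |a - b| < 1 := by
    rw [← Int.cast_sub, ← Int.cast_abs, ← Int.cast_one] at hk
    exact Int.cast_lt.1 hk
  rw [Int.abs_lt_one_iff, sub_eq_zero] at this
  rw [this]

namespace ANNAHead.IsIntegral

variable {N d m : ℕ} {A : ANNAHead d m}

theorem self_mem_nbhd (hA : A.IsIntegral) (Y : Matrix (Fin N) (Fin d) ℝ) (i : Fin N) {t : ℝ}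
    (ht : 0 ≤ t) : i ∈ A.nbhd Y i t := by
  rw [ANNAHead.mem_nbhd, hA.query_eq_key, dist_self]
  exact ht

theorem mem_nbhd_zero (hA : A.IsIntegral) (Y : Matrix (Fin N) (Fin d) ℝ) (i j : Fin N) :
    j ∈ A.nbhd Y i 0 ↔ A.K (Y j) = A.K (Y i) := by
  rw [ANNAHead.mem_nbhd, hA.query_eq_key, dist_le_zero, eq_comm]

theorem nbhd_eq (hA : A.IsIntegral) (Y : Matrix (Fin N) (Fin d) ℝ) (i : Fin N) {t : ℝ}
    (ht : 0 ≤ t) (ht1 : t < 1) : A.nbhd Y i t = A.nbhd Y i 0 := by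
  ext j
  rw [hA.mem_nbhd_zero, ANNAHead.mem_nbhd, hA.query_eq_key]
  constructor
  · intro h
    exact (EuclideanSpace.eq_of_dist_lt_one (hA.exists_int _) (hA.exists_int _)
      (h.trans_lt ht1)).symm
  · intro h
    rw [h, dist_self]
    exact ht

theorem card_nbhd_pos (hA : A.IsIntegral) (Y : Matrix (Fin N) (Fin d) ℝ) (i : Fin N) :
    0 < (A.nbhd Y i 0).card :=
  Finset.card_pos.2 ⟨i, hA.self_mem_nbhd Y i le_rfl⟩

/-- With spread parameter one, good weights are uniform on the tokens matching the query. -/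
theorem mul_eq_classMean (hA : A.IsIntegral) (Y : Matrix (Fin N) (Fin d) ℝ) {ρ c : ℝ}
    (hρ : 0 ≤ ρ) (hρ1 : ρ < 1) (hc : 0 ≤ c * ρ) (hc1 : c * ρ < 1)
    {w : Matrix (Fin N) (Fin N) ℝ} (hw0 : ∀ i j, 0 ≤ w i j) (hw1 : ∀ i, ∑ j, w i j = 1)
    (hw : A.GoodWeights Y ρ c 1 w) : w * rowwise A.V Y = A.classMean Y := by
  ext i k
  have hpos : (0 : ℝ) < (A.nbhd Y i 0).card := by exact_mod_cast hA.card_nbhd_pos Y i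
  have hle : ∀ j ∈ A.nbhd Y i 0, 1 / ((A.nbhd Y i 0).card : ℝ) ≤ w i j := by
    intro j hj
    have := hw.le_of_near i j (by rwa [hA.nbhd_eq Y i hρ hρ1])
    rwa [hA.nbhd_eq Y i hc hc1, mul_one, sub_add_cancel] at this
  have hzero : ∀ j, j ∉ A.nbhd Y i 0 → w i j = 0 := by
    intro j hj
    by_contra hne
    have := hw.near_of_pos i j ((hw0 i j).lt_of_ne' hne)
    rw [hA.nbhd_eq Y i hc hc1] at this
    exact hj this
  have hsum : ∑ j ∈ A.nbhd Y i 0, w i j = 1 := by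
    rw [← hw1 i]
    exact Finset.sum_subset (Finset.subset_univ _) fun j _ hj => hzero j hj
  -- The lower bounds `1 / n` on the `n` matching tokens already add up to the total weight one, so
  -- none of them is strict.
  have heq := (Finset.sum_eq_sum_iff_of_le hle).1 (by
    rw [hsum, Finset.sum_const, nsmul_eq_mul, mul_one_div_cancel hpos.ne'])
  rw [Matrix.mul_apply, ANNAHead.classMean, Matrix.of_apply, Finset.sum_div]
  rw [← Finset.sum_subset (Finset.subset_univ (A.nbhd Y i 0))
    fun j _ hj => by rw [hzero j hj, zero_mul]]
  refine Finset.sum_congr rfl fun j hj => ?_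
  rw [← heq j hj, rowwise, Matrix.of_apply]
  ring

/-- Hash functions that separate integer vectors retrieve the tokens matching the query. -/
theorem bucket_eq (hA : A.IsIntegral) (Y : Matrix (Fin N) (Fin d) ℝ) {C : Type}
    {g : EuclideanSpace ℝ (Fin m) → C}
    (hg : ∀ x y : EuclideanSpace ℝ (Fin m), (∀ k, ∃ n : ℤ, x k = n) → (∀ k, ∃ n : ℤ, y k = n) →
      g x = g y → x = y)
    (i : Fin N) : A.bucket g Y (g (A.Q (Y i))) = A.nbhd Y i 0 := by
  ext j
  rw [hA.mem_nbhd_zero, hA.query_eq_key]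
  simp only [ANNAHead.bucket, Finset.mem_filter]
  exact ⟨fun h => hg _ _ (hA.exists_int _) (hA.exists_int _) h.2,
    fun h => ⟨Finset.mem_univ _, by rw [h]⟩⟩

theorem hashCount_eq (hA : A.IsIntegral) (Y : Matrix (Fin N) (Fin d) ℝ) {C : Type} {ell : ℕ}
    {g : Fin ell → EuclideanSpace ℝ (Fin m) → C}
    (hg : ∀ u, ∀ x y : EuclideanSpace ℝ (Fin m), (∀ k, ∃ n : ℤ, x k = n) →
      (∀ k, ∃ n : ℤ, y k = n) → g u x = g u y → x = y)
    (i : Fin N) : A.hashCount g Y i = ell * (A.nbhd Y i 0).card := by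
  simp [ANNAHead.hashCount, hA.bucket_eq Y (hg _)]

theorem hashAttn_eq (hA : A.IsIntegral) (Y : Matrix (Fin N) (Fin d) ℝ) {C : Type} {ell : ℕ}
    (hell : 1 ≤ ell) {g : Fin ell → EuclideanSpace ℝ (Fin m) → C}
    (hg : ∀ u, ∀ x y : EuclideanSpace ℝ (Fin m), (∀ k, ∃ n : ℤ, x k = n) →
      (∀ k, ∃ n : ℤ, y k = n) → g u x = g u y → x = y) :
    A.hashAttn g Y = A.classMean Y := by
  ext i k
  have hell' : (ell : ℝ) ≠ 0 := by exact_mod_cast (by omega : ell ≠ 0)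
  rw [ANNAHead.hashAttn, Matrix.of_apply, hA.hashCount_eq Y hg, ANNAHead.hashSum]
  simp only [hA.bucket_eq Y (hg _), Finset.sum_const, Finset.card_univ, Fintype.card_fin,
    Finset.sum_apply, nsmul_eq_mul, Nat.cast_mul, ANNAHead.classMean,
    Matrix.of_apply]
  exact mul_div_mul_left _ _ hell'

/-- If the value is determined by the key, exact matching returns the token's own value. -/
theorem classMean_of_factors (hA : A.IsIntegral) (Y : Matrix (Fin N) (Fin d) ℝ)
    (hV : ∀ y y', A.K y = A.K y' → A.V y = A.V y') (i : Fin N) (k : Fin m) :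
    A.classMean Y i k = A.V (Y i) k := by
  have hpos : (0 : ℝ) < (A.nbhd Y i 0).card := by exact_mod_cast hA.card_nbhd_pos Y i
  rw [ANNAHead.classMean, Matrix.of_apply, Finset.sum_congr rfl fun j hj => by
    rw [hV _ _ ((hA.mem_nbhd_zero Y i j).1 hj)]]
  rw [Finset.sum_const, nsmul_eq_mul, mul_div_cancel_left₀ _ hpos.ne']

/-- If all keys agree, exact matching returns the mean over all tokens. -/
theorem classMean_of_const (hA : A.IsIntegral) (Y : Matrix (Fin N) (Fin d) ℝ)
    (hK : ∀ y y', A.K y = A.K y') (i : Fin N) (k : Fin m) :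
    A.classMean Y i k = (∑ j, A.V (Y j) k) / N := by
  have : A.nbhd Y i 0 = Finset.univ :=
    Finset.eq_univ_of_forall fun j => (hA.mem_nbhd_zero Y i j).2 (hK _ _)
  rw [ANNAHead.classMean, Matrix.of_apply, this, Finset.card_univ, Fintype.card_fin]

end ANNAHead.IsIntegral

/-! ### Randomly shifted grids -/

/-- The cell of the unit grid, shifted by `s / M`, that contains `x`. -/
noncomputable def gridHash (M : ℕ) {m : ℕ} (s : Fin M) (x : EuclideanSpace ℝ (Fin m)) :
    Fin m → ℤ :=
  fun k => ⌊x k + (s : ℕ) / (M : ℝ)⌋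

/-- The floor commutes with integer translations, so a shift adds the same constant to the cell
index of every integer. This holds for each shift, not just with some probability. -/
theorem gridHash_injOn_int {M m : ℕ} (s : Fin M) {x y : EuclideanSpace ℝ (Fin m)}
    (hx : ∀ k, ∃ n : ℤ, x k = n) (hy : ∀ k, ∃ n : ℤ, y k = n)
    (h : gridHash M s x = gridHash M s y) : x = y := by
  ext k
  obtain ⟨a, ha⟩ := hx k
  obtain ⟨b, hb⟩ := hy k
  have hk := congrFun h k
  simp only [gridHash, ha, hb, Int.floor_intCast_add, add_left_inj] at hk
  rw [ha, hb, hk]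

theorem floor_add_div_ne_unique_of_le {M : ℕ} {x y : ℝ} (hxy : x ≤ y) (h : y - x < 1 / M)
    {s t : Fin M} (hs : ⌊x + (s : ℕ) / (M : ℝ)⌋ ≠ ⌊y + (s : ℕ) / (M : ℝ)⌋)
    (ht : ⌊x + (t : ℕ) / (M : ℝ)⌋ ≠ ⌊y + (t : ℕ) / (M : ℝ)⌋) : s = t := by
  have hM : (0 : ℝ) < M := by exact_mod_cast s.pos
  -- If shift `u` separates `x` from `y`, then `M * n - u` lies in the interval from `M * x`
  -- (excluded) to `M * y` for some integer `n`.
  have key : ∀ u : Fin M, ⌊x + (u : ℕ) / (M : ℝ)⌋ ≠ ⌊y + (u : ℕ) / (M : ℝ)⌋ →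
      ∃ n : ℤ, M * x + (u : ℕ) < M * n ∧ (M : ℝ) * n ≤ M * y + (u : ℕ) := by
    intro u hu
    have hlt : ⌊x + (u : ℕ) / (M : ℝ)⌋ < ⌊y + (u : ℕ) / (M : ℝ)⌋ :=
      (Int.floor_le_floor (by linarith)).lt_of_ne hu
    have h1 := Int.floor_lt.1 hlt
    have h2 := Int.floor_le (y + (u : ℕ) / (M : ℝ))
    refine ⟨⌊y + (u : ℕ) / (M : ℝ)⌋, ?_, ?_⟩
    · have := mul_lt_mul_of_pos_left h1 hM
      rwa [mul_add, mul_div_cancel₀ _ hM.ne'] at this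
    · have := mul_le_mul_of_nonneg_left h2 hM.le
      rwa [mul_add, mul_div_cancel₀ _ hM.ne'] at this
  obtain ⟨a, ha1, ha2⟩ := key s hs
  obtain ⟨b, hb1, hb2⟩ := key t ht
  have hd : (M : ℝ) * y - M * x < 1 := by
    have := mul_lt_mul_of_pos_left h hM
    rwa [mul_sub, mul_one_div_cancel hM.ne'] at this
  -- That interval is shorter than one, so the integers `M * a - s` and `M * b - t` coincide;
  -- reducing modulo `M` gives `s = t`.
  have e1 : (M : ℤ) * a + t < M * b + s + 1 := by
    have : (M : ℝ) * a + (t : ℕ) < M * b + (s : ℕ) + 1 := by linarith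
    exact_mod_cast this
  have e2 : (M : ℤ) * b + s < M * a + t + 1 := by
    have : (M : ℝ) * b + (s : ℕ) < M * a + (t : ℕ) + 1 := by linarith
    exact_mod_cast this
  have e : (M : ℤ) * a + t = M * b + s := by omega
  have hmod : ((t : ℕ) : ℤ) % M = ((s : ℕ) : ℤ) % M := by
    have := congrArg (· % (M : ℤ)) e
    simpa [Int.add_emod, Int.mul_emod_right] using this
  have hs' := s.isLt
  have ht' := t.isLt
  rw [Int.emod_eq_of_lt (by omega) (by omega), Int.emod_eq_of_lt (by omega) (by omega)] at hmod
  ext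
  omega

/-- Two close numbers are separated by at most one shift of the grid. -/
theorem floor_add_div_ne_unique {M : ℕ} {x y : ℝ} (h : |x - y| < 1 / M)
    {s t : Fin M} (hs : ⌊x + (s : ℕ) / (M : ℝ)⌋ ≠ ⌊y + (s : ℕ) / (M : ℝ)⌋)
    (ht : ⌊x + (t : ℕ) / (M : ℝ)⌋ ≠ ⌊y + (t : ℕ) / (M : ℝ)⌋) : s = t := by
  rw [abs_sub_lt_iff] at h
  rcases le_total x y with hxy | hxy
  · exact floor_add_div_ne_unique_of_le hxy h.2 hs ht
  · exact floor_add_div_ne_unique_of_le hxy h.1 hs.symm ht.symm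

/-- Union bound over coordinates: each one is responsible for at most one separating shift. -/
theorem card_gridHash_ne_le {M m : ℕ} {x y : EuclideanSpace ℝ (Fin m)} (h : dist x y < 1 / M) :
    (Finset.univ.filter fun s : Fin M => gridHash M s x ≠ gridHash M s y).card ≤ m := by
  have hsub : (Finset.univ.filter fun s : Fin M => gridHash M s x ≠ gridHash M s y) ⊆
      Finset.univ.biUnion fun k : Fin m =>
        Finset.univ.filter fun s : Fin M => gridHash M s x k ≠ gridHash M s y k := by
    intro s hs
    obtain ⟨k, hk⟩ := Function.ne_iff.1 (Finset.mem_filter.1 hs).2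
    simpa using ⟨k, hk⟩
  refine (Finset.card_le_card hsub).trans ?_
  refine (Finset.card_biUnion_le_card_mul _ _ 1 fun k _ => ?_).trans (by simp)
  rw [Finset.card_le_one]
  intro s hs t ht
  exact floor_add_div_ne_unique ((EuclideanSpace.abs_sub_le_dist x y k).trans_lt h)
    (Finset.mem_filter.1 hs).2 (Finset.mem_filter.1 ht).2

theorem dist_lt_of_gridHash_eq {M m : ℕ} {s : Fin M} {x y : EuclideanSpace ℝ (Fin m)}
    (h : gridHash M s x = gridHash M s y) : dist x y < m + 1 := by
  have hk : ∀ k, |x k - y k| < 1 := fun k => by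
    simpa using Int.abs_sub_lt_one_of_floor_eq_floor (congrFun h k)
  rw [EuclideanSpace.dist_eq, Real.sqrt_lt' (by positivity)]
  calc ∑ k, dist (x k) (y k) ^ 2 ≤ ∑ _k : Fin m, (1 : ℝ) := by
        refine Finset.sum_le_sum fun k _ => ?_
        rw [Real.dist_eq]
        exact pow_le_one₀ (abs_nonneg _) (hk k).le
    _ = m := by simp
    _ < ((m : ℝ) + 1) ^ 2 := by nlinarith [Nat.cast_nonneg (α := ℝ) m]

/-- For radii `ρ < 1 / (2 m + 2)` and `R ≥ m + 1`, the grid with one of `2 m + 2` shifts keeps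
close points together with probability one half and separates distant points surely. -/
theorem isLSHFamily_gridHash (m : ℕ) {ρ R p₂ : ℝ} (hρ : ρ < 1 / ((2 * m + 2 : ℕ) : ℝ))
    (hR : (m : ℝ) + 1 ≤ R) :
    IsLSHFamily (m := m) (PMF.uniformOfFintype (Fin (2 * m + 2))).toMeasure
      (gridHash (2 * m + 2)) ρ R (1 / 2) p₂ where
  prob := inferInstance
  measurable _ _ := Set.Finite.measurableSet (Set.toFinite _)
  near x y h := by
    rw [PMF.toMeasure_uniformOfFintype_apply _ (Set.Finite.measurableSet (Set.toFinite _)),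
      Fintype.card_fin, Fintype.card_subtype]
    have hbad := card_gridHash_ne_le (h.trans_lt hρ)
    -- At most `m` of the `2 * m + 2` shifts separate the points, so at least half of the shifts
    -- keep them together.
    have htot := Finset.card_filter_add_card_filter_not (s := Finset.univ)
      fun s : Fin (2 * m + 2) => gridHash (2 * m + 2) s x = gridHash (2 * m + 2) s y
    rw [Finset.card_univ, Fintype.card_fin] at htot
    have hgood : m + 1 ≤ (Finset.univ.filter fun s : Fin (2 * m + 2) =>
        s ∈ {s | gridHash (2 * m + 2) s x = gridHash (2 * m + 2) s y}).card := by
      simp only [Set.mem_ofPred_eq]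
      simp only [ne_eq] at hbad
      omega
    rw [ENNReal.le_div_iff_mul_le (by simp) (by simp)]
    refine le_trans (le_of_eq ?_) (Nat.cast_le.2 hgood)
    rw [← ENNReal.ofReal_natCast, ← ENNReal.ofReal_natCast, ← ENNReal.ofReal_mul (by norm_num)]
    congr 1
    push_cast
    ring
  far x y h := by
    have : {s : Fin (2 * m + 2) | gridHash (2 * m + 2) s x = gridHash (2 * m + 2) s y} = ∅ := by
      rw [Set.eq_empty_iff_forall_notMem]
      intro s hs
      exact absurd (dist_lt_of_gridHash_eq hs) (not_lt.2 (hR.trans h.le))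
    rw [this, measure_empty]
    exact zero_le

/-! ### Folds along a trajectory -/

theorem exists_fin_trajectory {α : Type*} (L : ℕ) (f : Fin L → α → α) (x : α) :
    ∃ u : ℕ → α, u 0 = x ∧ ∀ l : Fin L, u (l + 1) = f l (u l) :=
  -- Beyond index `L` the sequence stays constant; these values are never used.
  ⟨fun n => Nat.rec x (fun l y => if h : l < L then f ⟨l, h⟩ y else y) n, rfl,
    fun l => by simp⟩

theorem Fin.foldl_eq_trajectory {α : Type*} {L : ℕ} (f : Fin L → α → α) (u : ℕ → α)
    (hu : ∀ l : Fin L, u (l + 1) = f l (u l)) :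
    Fin.foldl L (fun y l => f l y) (u 0) = u L := by
  induction L with
  | zero => simp
  | succ L ih =>
    rw [Fin.foldl_succ_last, ih (fun l => f l.castSucc) fun l => hu l.castSucc]
    exact (hu (Fin.last L)).symm

/-! ### The simulating transformer -/

section Simulation

variable {d r m H L : ℕ}

/-- Coordinates of the embedding are indexed by a head, a rank index and a value index. -/
def coordEquiv (H r m : ℕ) : Fin (H * r * m) ≃ (Fin H × Fin r) × Fin m :=
  finProdFinEquiv.symm.trans (Equiv.prodCongr finProdFinEquiv.symm (Equiv.refl _))

/-- The token coordinates storing the query features. -/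
def querySlot (d : ℕ) {D : ℕ} (e : Fin D) : Fin (d + (D + D)) := Fin.natAdd d (Fin.castAdd D e)

/-- The token coordinates storing the means of the products of key and value features. -/
def meanSlot (d : ℕ) {D : ℕ} (e : Fin D) : Fin (d + (D + D)) := Fin.natAdd d (Fin.natAdd D e)

/-- The matrix that writes entry `e` of an embedding to token coordinate `slot e`. -/
def slotMatrix {D d' : ℕ} (slot : Fin D → Fin d') : Matrix (Fin D) (Fin d') ℝ :=
  Matrix.of fun e k => if slot e = k then 1 else 0

/-- The entry `e` of the query features of all heads. -/
def LowRankLayer.queryFeature (f : LowRankLayer d r m H) (x : Fin d → ℝ)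
    (e : Fin (H * r * m)) : ℝ :=
  (f.head (coordEquiv H r m e).1.1).Q x (coordEquiv H r m e).1.2

/-- The entry `e` of the outer products of key and value features of all heads. -/
def LowRankLayer.keyValueFeature (f : LowRankLayer d r m H) (x : Fin d → ℝ)
    (e : Fin (H * r * m)) : ℝ :=
  (f.head (coordEquiv H r m e).1.1).K x (coordEquiv H r m e).1.2 *
    (f.head (coordEquiv H r m e).1.1).V x (coordEquiv H r m e).2

/-- Reassociating the matrix products separates the token's own query features from the sums over
all tokens, which are the same for every row `i`. -/
theorem LowRankLayer.apply_eq_sum {N : ℕ} (f : LowRankLayer d r m H)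
    (X : Matrix (Fin N) (Fin d) ℝ) (i : Fin N) (k : Fin d) :
    f.apply X i k = ∑ e, f.queryFeature (X i) e * (∑ j, f.keyValueFeature (X j) e) *
      f.W (coordEquiv H r m e).1.1 (coordEquiv H r m e).2 k := by
  simp only [LowRankLayer.queryFeature, LowRankLayer.keyValueFeature]
  rw [(coordEquiv H r m).sum_comp fun z => (f.head z.1.1).Q (X i) z.1.2 *
    (∑ j, (f.head z.1.1).K (X j) z.1.2 * (f.head z.1.1).V (X j) z.2) * f.W z.1.1 z.2 k,
    Fintype.sum_prod_type, Fintype.sum_prod_type, LowRankLayer.apply, Matrix.sum_apply]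
  refine Finset.sum_congr rfl fun h _ => ?_
  rw [Matrix.mul_apply, Finset.sum_comm]
  refine Finset.sum_congr rfl fun b _ => ?_
  rw [LowRankHead.attn, Matrix.mul_apply, Finset.sum_mul]
  rfl

/-- Recover the token of the low-rank transformer before layer `l` from a token of the
simulating transformer. -/
def LowRankTransformer.decode (T : LowRankTransformer d r m H L) (N : ℕ) :
    ℕ → (Fin (d + (H * r * m + H * r * m)) → ℝ) → Fin d → ℝ
  | 0, y => fun k => y (Fin.castAdd _ k)
  -- The factor `N` turns the stored mean back into a sum.
  | l + 1, y => fun k => if h : l < L then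
      ∑ e, y (querySlot d e) * (N * y (meanSlot d e)) *
        (T.layer ⟨l, h⟩).W (coordEquiv H r m e).1.1 (coordEquiv H r m e).2 k
    else 0

/-- The head that preserves the query features, by exact matching of these features. -/
noncomputable def LowRankLayer.queryHead (f : LowRankLayer d r m H) (p : ℕ) {d' : ℕ}
    (dec : (Fin d' → ℝ) → Fin d → ℝ) : ANNAHead d' (H * r * m) where
  -- Scaling by `2 ^ p` makes fixed-point features integral.
  Q y := WithLp.toLp 2 fun e => 2 ^ p * f.queryFeature (dec y) e
  K y := WithLp.toLp 2 fun e => 2 ^ p * f.queryFeature (dec y) e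
  V y := f.queryFeature (dec y)

/-- The head that averages the products of key and value features over all tokens. -/
noncomputable def LowRankLayer.meanHead (f : LowRankLayer d r m H) {d' : ℕ}
    (dec : (Fin d' → ℝ) → Fin d → ℝ) : ANNAHead d' (H * r * m) where
  Q _ := 0
  K _ := 0
  V y := f.keyValueFeature (dec y)

/-- The ANNA transformer simulating `T` on context length `N`. -/
noncomputable def LowRankTransformer.simulate (T : LowRankTransformer d r m H L) (N p : ℕ) :
    ANNATransformer (d + (H * r * m + H * r * m)) (H * r * m) 2 L where
  layer l :=
    { head := ![(T.layer l).queryHead p (T.decode N l), (T.layer l).meanHead (T.decode N l)]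
      W := ![slotMatrix (querySlot d), slotMatrix (meanSlot d)] }
  ψ y := padVec _ (T.ψ (T.decode N L y))

theorem querySlot_eq_iff {D : ℕ} (e e' : Fin D) : querySlot d e = querySlot d e' ↔ e = e' := by
  simp [querySlot, Fin.ext_iff]

theorem meanSlot_eq_iff {D : ℕ} (e e' : Fin D) : meanSlot d e = meanSlot d e' ↔ e = e' := by
  simp [meanSlot, Fin.ext_iff]

theorem querySlot_ne_meanSlot {D : ℕ} (e e' : Fin D) : querySlot d e ≠ meanSlot d e' := by
  simp only [querySlot, meanSlot, ne_eq, Fin.ext_iff, Fin.val_natAdd, Fin.val_castAdd]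
  have := e.isLt
  omega

/-! ### Precision -/

theorem IsFixedPoint.mono {p q : ℕ} (hpq : p ≤ q) {x : ℝ} (h : IsFixedPoint p x) :
    IsFixedPoint q x := by
  obtain ⟨a, ha, rfl⟩ := h
  obtain ⟨k, rfl⟩ := Nat.exists_eq_add_of_le hpq
  refine ⟨a * 2 ^ k, ?_, ?_⟩
  · rw [abs_mul, abs_of_pos (by positivity : (0 : ℤ) < 2 ^ k)]
    calc |a| * 2 ^ k ≤ 2 ^ (2 * p) * 2 ^ k := by gcongr
      _ = 2 ^ (2 * p + k) := (pow_add _ _ _).symm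
      _ ≤ 2 ^ (2 * (p + k)) := pow_le_pow_right₀ (by norm_num) (by omega)
  · push_cast
    rw [pow_add]
    field_simp

theorem isFixedPoint_zero (p : ℕ) : IsFixedPoint p 0 := ⟨0, by simp, by simp⟩

theorem isFixedPoint_one (p : ℕ) : IsFixedPoint p 1 :=
  IsFixedPoint.mono p.zero_le ⟨1, by simp, by simp⟩

theorem IsFixedPoint.mul {p : ℕ} {x y : ℝ} (hx : IsFixedPoint p x) (hy : IsFixedPoint p y) :
    IsFixedPoint (2 * p) (x * y) := by
  obtain ⟨a, ha, rfl⟩ := hx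
  obtain ⟨b, hb, rfl⟩ := hy
  refine ⟨a * b, ?_, ?_⟩
  · rw [abs_mul]
    calc |a| * |b| ≤ 2 ^ (2 * p) * 2 ^ (2 * p) := by gcongr
      _ = 2 ^ (2 * (2 * p)) := by ring
  · push_cast
    rw [div_mul_div_comm, ← pow_add, two_mul]

theorem isFixedPoint_two_pow (p : ℕ) : IsFixedPoint p (2 ^ p) :=
  ⟨2 ^ (2 * p), by simp, by push_cast; rw [two_mul, pow_add]; field_simp⟩

theorem IsFixedPoint.exists_int {p : ℕ} {x : ℝ} (hx : IsFixedPoint p x) :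
    ∃ n : ℤ, 2 ^ p * x = n := by
  obtain ⟨a, -, rfl⟩ := hx
  exact ⟨a, mul_div_cancel₀ _ (by positivity)⟩

theorem isFixedPoint_padVec {p d d' : ℕ} {x : Fin d → ℝ} (hx : ∀ k, IsFixedPoint p (x k))
    (k : Fin d') : IsFixedPoint p (padVec d' x k) := by
  rw [padVec]
  split_ifs
  · exact hx _
  · exact isFixedPoint_zero p

variable {T : LowRankTransformer d r m H L} {p : ℕ}

/-- Precision doubles because of the products: key times value, and `2 ^ p` times a query feature.
The output matrices have entries zero and one only. -/
theorem LowRankTransformer.HasPrecision.simulate (hT : T.HasPrecision p) (N : ℕ) :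
    (T.simulate N p).HasPrecision (2 * p) where
  query l h x k := by
    fin_cases h
    · exact (isFixedPoint_two_pow p).mul (hT.query l _ _ _)
    · exact isFixedPoint_zero _
  key l h x k := by
    fin_cases h
    · exact (isFixedPoint_two_pow p).mul (hT.query l _ _ _)
    · exact isFixedPoint_zero _
  value l h x k := by
    fin_cases h
    · exact (hT.query l _ _ _).mono (by omega)
    · exact (hT.key l _ _ _).mul (hT.value l _ _ _)
  matrix l h a b := by
    have (q : Prop) [Decidable q] : IsFixedPoint (2 * p) (if q then 1 else 0) := by
      split_ifs
      exacts [isFixedPoint_one _, isFixedPoint_zero _]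
    fin_cases h <;> exact this _
  output x k := isFixedPoint_padVec (fun k => (hT.output _ k).mono (by omega)) k

theorem LowRankTransformer.HasPrecision.isIntegral_simulate (hT : T.HasPrecision p) (N : ℕ)
    (l : Fin L) (h : Fin 2) : (((T.simulate N p).layer l).head h).IsIntegral := by
  fin_cases h
  · exact ⟨rfl, fun y k => (hT.query l _ _ _).exists_int⟩
  · exact ⟨rfl, fun y k => ⟨0, by simp [LowRankTransformer.simulate, LowRankLayer.meanHead]⟩⟩

/-! ### Correctness -/

/-- The simulating layer, with exact matching, applied to a matrix of tokens. -/
noncomputable def LowRankTransformer.simulateStep (T : LowRankTransformer d r m H L) (N p : ℕ)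
    (l : Fin L) (Y : Matrix (Fin N) (Fin (d + (H * r * m + H * r * m))) ℝ) :
    Matrix (Fin N) (Fin (d + (H * r * m + H * r * m))) ℝ :=
  ∑ h, (((T.simulate N p).layer l).head h).classMean Y * ((T.simulate N p).layer l).W h

theorem LowRankTransformer.simulateStep_eq (T : LowRankTransformer d r m H L) (N p : ℕ)
    (l : Fin L) (Y : Matrix (Fin N) (Fin (d + (H * r * m + H * r * m))) ℝ) :
    T.simulateStep N p l Y =
      ((T.layer l).queryHead p (T.decode N l)).classMean Y *
        (slotMatrix (querySlot d) : Matrix (Fin (H * r * m)) _ ℝ) +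
      ((T.layer l).meanHead (T.decode N l)).classMean Y *
        (slotMatrix (meanSlot d) : Matrix (Fin (H * r * m)) _ ℝ) :=
  Fin.sum_univ_two _

theorem LowRankTransformer.HasPrecision.simulateStep_querySlot (hT : T.HasPrecision p) {N : ℕ}
    (l : Fin L) (Y : Matrix (Fin N) (Fin (d + (H * r * m + H * r * m))) ℝ) (i : Fin N)
    (e : Fin (H * r * m)) :
    T.simulateStep N p l Y i (querySlot d e) =
      (T.layer l).queryFeature (T.decode N l (Y i)) e := by
  have hfac := (hT.isIntegral_simulate N l 0).classMean_of_factors Y (fun y y' h => by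
    funext k
    have hk := congrFun (congrArg WithLp.ofLp h) k
    exact mul_left_cancel₀ (by positivity : (2 : ℝ) ^ p ≠ 0) hk) i e
  rw [T.simulateStep_eq, Matrix.add_apply, Matrix.mul_apply, Matrix.mul_apply]
  simp only [slotMatrix, Matrix.of_apply,
    querySlot_eq_iff, (querySlot_ne_meanSlot _ _).symm, if_false, mul_ite, mul_one, mul_zero,
    Finset.sum_ite_eq', Finset.mem_univ, if_true, Finset.sum_const_zero, add_zero]
  exact hfac

theorem LowRankTransformer.HasPrecision.simulateStep_meanSlot (hT : T.HasPrecision p) {N : ℕ}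
    (l : Fin L) (Y : Matrix (Fin N) (Fin (d + (H * r * m + H * r * m))) ℝ) (i : Fin N)
    (e : Fin (H * r * m)) :
    T.simulateStep N p l Y i (meanSlot d e) =
      (∑ j, (T.layer l).keyValueFeature (T.decode N l (Y j)) e) / N := by
  have hconst := (hT.isIntegral_simulate N l 1).classMean_of_const Y (fun y y' => rfl) i e
  rw [T.simulateStep_eq, Matrix.add_apply, Matrix.mul_apply, Matrix.mul_apply]
  simp only [slotMatrix, Matrix.of_apply,
    meanSlot_eq_iff, querySlot_ne_meanSlot, if_false, mul_ite, mul_one, mul_zero,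
    Finset.sum_ite_eq', Finset.mem_univ, if_true, Finset.sum_const_zero, zero_add]
  exact hconst

theorem LowRankTransformer.HasPrecision.decode_simulateStep (hT : T.HasPrecision p) {N : ℕ}
    (hN : N ≠ 0) (l : Fin L) (Y : Matrix (Fin N) (Fin (d + (H * r * m + H * r * m))) ℝ) :
    rowwise (T.decode N (l + 1)) (T.simulateStep N p l Y) =
      (T.layer l).apply (rowwise (T.decode N l) Y) := by
  have hN' : (N : ℝ) ≠ 0 := by exact_mod_cast hN
  ext i k
  rw [LowRankLayer.apply_eq_sum]
  simp only [rowwise, Matrix.of_apply, decode, l.isLt, dite_true, hT.simulateStep_querySlot,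
    hT.simulateStep_meanSlot, mul_div_cancel₀ _ hN']
  rfl

theorem LowRankTransformer.decode_zero_padVec (T : LowRankTransformer d r m H L) (N : ℕ)
    (x : Fin d → ℝ) : T.decode N 0 (padVec _ x) = x := by
  funext k
  simp [decode, padVec]

/-- Along the trajectory of the simulation with exact matching, agreement of the attention
mechanisms with exact matching suffices for a correct output. -/
theorem LowRankTransformer.HasPrecision.exists_trajectory (hT : T.HasPrecision p) {N : ℕ}
    (hN : N ≠ 0) (X : Matrix (Fin N) (Fin d) ℝ) :
    ∃ u : ℕ → Matrix (Fin N) (Fin (d + (H * r * m + H * r * m))) ℝ,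
      ∀ att : Fin L → Fin 2 → Matrix (Fin N) (Fin (d + (H * r * m + H * r * m))) ℝ →
          Matrix (Fin N) (Fin (H * r * m)) ℝ,
        (∀ l h, att l h (u l) = (((T.simulate N p).layer l).head h).classMean (u l)) →
        (T.simulate N p).run att (rowwise (padVec _) X) = rowwise (padVec _) (T.eval X) := by
  obtain ⟨u, hu0, hu⟩ := exists_fin_trajectory L (T.simulateStep N p) (rowwise (padVec _) X)
  refine ⟨u, fun att hatt => ?_⟩
  have hrun := Fin.foldl_eq_trajectory
    (fun l Y => ∑ h, att l h Y * ((T.simulate N p).layer l).W h) u fun l => by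
      rw [hu, simulateStep]
      simp only [hatt]
  -- Decoding the simulated trajectory gives the trajectory of `T`.
  have hdec := Fin.foldl_eq_trajectory (fun l Y => (T.layer l).apply Y)
    (fun l => rowwise (T.decode N l) (u l)) fun l => by
      simp only [hu, hT.decode_simulateStep hN]
  have h0 : rowwise (T.decode N 0) (u 0) = X := by
    rw [hu0]
    funext i
    exact T.decode_zero_padVec N (X i)
  rw [h0] at hdec
  rw [hu0] at hrun
  rw [ANNATransformer.run, hrun, LowRankTransformer.eval, hdec]
  rfl

theorem LowRankTransformer.HasPrecision.computes_simulate (hT : T.HasPrecision p) {N : ℕ}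
    (hN : N ≠ 0) : (T.simulate N p).Computes (N := N) T.eval := by
  intro c hc
  have hc0 : 0 < c := zero_lt_one.trans hc
  have hr : c * (1 / (2 * c)) = 1 / 2 := by field_simp
  have hr1 : 1 / (2 * c) < 1 := by
    rw [div_lt_one (by positivity)]
    linarith
  -- With this radius `c * ρ = 1 / 2`, below the minimal distance of distinct integer vectors.
  refine ⟨1 / (2 * c), by positivity, fun l h Y i =>
    ⟨i, (hT.isIntegral_simulate N l h).self_mem_nbhd Y i (by positivity)⟩, ?_⟩
  intro Ω _ P _ w hw X
  obtain ⟨u, hu⟩ := hT.exists_trajectory hN X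
  -- Failure is a null event only for each fixed input. The trajectory `u` does not depend on `ω`,
  -- so finitely many null events are to be excluded; outside them the actual run follows `u`.
  have hgood : ∀ᵐ ω ∂P, ∀ l h, (((T.simulate N p).layer l).head h).GoodWeights (u l)
      (1 / (2 * c)) c 1 (w l h ω (u l)) := by
    rw [ae_all_iff]
    intro l
    rw [ae_all_iff]
    intro h
    have := (hw l h).good (u l)
    rw [ENNReal.ofReal_zero] at this
    exact ae_iff.2 (le_antisymm this zero_le)
  filter_upwards [hgood] with ω hω
  refine hu _ fun l h => ?_
  exact (hT.isIntegral_simulate N l h).mul_eq_classMean (u l) (by positivity) hr1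
    (by rw [hr]; norm_num) (by rw [hr]; norm_num) ((hw l h).nonneg ω _) ((hw l h).sum_eq_one ω _)
    (hω l h)

theorem LowRankTransformer.HasPrecision.hashComputes_simulate (hT : T.HasPrecision p) {N : ℕ}
    (hN : N ≠ 0) : (T.simulate N p).HashComputes (N := N) T.eval := by
  intro c₀
  have hM0 : (0 : ℝ) < ((2 * (H * r * m) + 2 : ℕ) : ℝ) := by positivity
  -- The last bound makes the radius `(D + 1) / c` smaller than the grid step `1 / (2 * D + 2)`.
  obtain ⟨c, hcc, hc1, hcM⟩ : ∃ c : ℝ, c₀ ≤ c ∧ 1 < c ∧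
      ((2 * (H * r * m) + 2 : ℕ) : ℝ) * (((H * r * m : ℕ) : ℝ) + 1) < c :=
    ⟨max c₀ (max 1 (((2 * (H * r * m) + 2 : ℕ) : ℝ) * (((H * r * m : ℕ) : ℝ) + 1))) + 1,
      by linarith [le_max_left c₀ (max 1 (((2 * (H * r * m) + 2 : ℕ) : ℝ) *
        (((H * r * m : ℕ) : ℝ) + 1)))],
      by linarith [(le_max_left 1 _).trans (le_max_right c₀ (max 1
        (((2 * (H * r * m) + 2 : ℕ) : ℝ) * (((H * r * m : ℕ) : ℝ) + 1))))],
      by linarith [(le_max_right 1 _).trans (le_max_right c₀ (max 1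
        (((2 * (H * r * m) + 2 : ℕ) : ℝ) * (((H * r * m : ℕ) : ℝ) + 1))))]⟩
  have hc0 : 0 < c := zero_lt_one.trans hc1
  have hlog : 0 < Real.log 2 := Real.log_pos one_lt_two
  -- The far radius is `D + 1`, beyond which no collisions occur. So `p₂` is free, and `(1 / 2) ^
  -- c²` makes the quality exactly `1 / c²`.
  refine ⟨c, (((H * r * m : ℕ) : ℝ) + 1) / c, 1 / 2, (1 / 2 : ℝ) ^ (c ^ 2), hcc, hc1,
    by positivity, by positivity, ?_, by norm_num, ?_, Fin (2 * (H * r * m) + 2),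
    Fin (H * r * m) → ℤ, inferInstance, _, gridHash _,
    isLSHFamily_gridHash _ ?_ (mul_div_cancel₀ _ hc0.ne').ge, ?_⟩
  · conv_rhs => rw [← Real.rpow_one (1 / 2 : ℝ)]
    exact Real.rpow_lt_rpow_of_exponent_gt (by norm_num) (by norm_num) (by nlinarith)
  · rw [one_div ((1 / 2 : ℝ) ^ (c ^ 2)), Real.log_inv, Real.log_rpow (by norm_num), one_div_one_div,
      one_div (2 : ℝ), Real.log_inv]
    apply le_of_eq
    field_simp
  · rw [div_lt_div_iff₀ hc0 hM0]
    linarith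
  · intro ell z hell hz seed
    -- A single hash function already separates integer vectors; `1 ≤ z` ensures there is one.
    have hsep : ∀ l a u (x y : EuclideanSpace ℝ (Fin (H * r * m))), (∀ k, ∃ n : ℤ, x k = n) →
        (∀ k, ∃ n : ℤ, y k = n) → hashCode (gridHash _) (seed l a) u x =
          hashCode (gridHash _) (seed l a) u y → x = y :=
      fun l a u x y hx hy h => gridHash_injOn_int _ hx hy (congrFun h ⟨0, hz⟩)
    refine ⟨fun l a Y i => ?_, fun X => ?_⟩
    · rw [(hT.isIntegral_simulate N l a).hashCount_eq Y (hsep l a)]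
      exact Nat.mul_pos hell ((hT.isIntegral_simulate N l a).card_nbhd_pos Y i)
    · obtain ⟨u, hu⟩ := hT.exists_trajectory hN X
      exact hu _ fun l a => (hT.isIntegral_simulate N l a).hashAttn_eq (u l) hell (hsep l a)

end Simulation

/-! ### Choice of constants -/

theorem theorem4p3 (ε ε' : ℝ) (hε : 0 < ε) (hεε' : ε < ε') (hε' : ε' < 1) :
    ∃ C_L : ℝ, ∀ C : ℝ, ∃ C' : ℝ,
      ∀ (N d r m H L p : ℕ), 2 ≤ N →
        ((H * r * m : ℕ) : ℝ) ≤ C * (N : ℝ) ^ ε →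
        (p : ℝ) ≤ C * Real.log N →
        ∀ T : LowRankTransformer d r m H L, T.HasPrecision p →
          ∃ (d' m' H' L' p' : ℕ) (T' : ANNATransformer d' m' H' L'),
            (L' : ℝ) ≤ C_L * L ∧
            (H' : ℝ) ≤ C' * (N : ℝ) ^ ((ε' - ε) / 4) ∧
            (m' : ℝ) ≤ C' * (N : ℝ) ^ ε' ∧
            d ≤ d' ∧ (d' : ℝ) ≤ d + C' * (N : ℝ) ^ ε' ∧
            (p' : ℝ) ≤ C' * Real.log N ∧
            T'.HasPrecision p' ∧
            T'.Computes (N := N) T.eval ∧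
            T'.HashComputes (N := N) T.eval := by
  -- Depth is preserved. The constant `2 * |C| + 2` covers the two heads, the two blocks of `D`
  -- extra coordinates and the doubled precision.
  refine ⟨1, fun C => ⟨2 * |C| + 2, fun N d r m H L p hN hD hp T hT => ?_⟩⟩
  have hN1 : (1 : ℝ) ≤ N := by exact_mod_cast (by omega : 1 ≤ N)
  have hN0 : N ≠ 0 := by omega
  have hlog : 0 ≤ Real.log N := Real.log_nonneg hN1
  have hC : C ≤ |C| := le_abs_self C
  have hC0 : 0 ≤ |C| := abs_nonneg C
  have hε1 : (1 : ℝ) ≤ (N : ℝ) ^ ε' := Real.one_le_rpow hN1 (by linarith)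
  have hD' : ((H * r * m : ℕ) : ℝ) ≤ |C| * (N : ℝ) ^ ε' :=
    calc ((H * r * m : ℕ) : ℝ) ≤ C * (N : ℝ) ^ ε := hD
      _ ≤ |C| * (N : ℝ) ^ ε' := by gcongr
  refine ⟨_, _, _, _, 2 * p, T.simulate N p, (one_mul _).ge, ?_, ?_, Nat.le_add_right _ _, ?_, ?_,
    hT.simulate N, hT.computes_simulate hN0, hT.hashComputes_simulate hN0⟩
  · have : (1 : ℝ) ≤ (N : ℝ) ^ ((ε' - ε) / 4) := Real.one_le_rpow hN1 (by linarith)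
    push_cast
    nlinarith
  · nlinarith
  · rw [Nat.cast_add d, Nat.cast_add (H * r * m)]
    nlinarith
  · push_cast
    nlinarith
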